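/- There is a universal constant $C>0$ such that the following holds. Let $G=(V,E,w)$ be a finite undirected graph (not necessarily connected) with $n=|V|\ge 3$ vertices and arbitrary finite positive edge weights $w$ (no bound on the aspect ratio), and let $h\in\{1,\dots,n\}$. Notation. Paths need not be simple; the number of hops of a path $P=(v_0,\dots,v_m)$ is $m$ and its weight is $w(P)=\sum_{i<m}w(v_i,v_{i+1})$. $d_G$ is the shortest path distance ($\infty$ between different components), and for real $r$, $d_G^{(r)}(u,v)$ is the minimum weight of a $u$–$v$ path with at most $r$ hops ($\infty$ if there is none). A path $P$ is $h$-respecting if $d_G^{(h)}(u,v)\le d_P(u,v)$ for all vertices $u,v$ of $P$, where $d_P$ is the shortest path distance in the subgraph formed by the vertices and edges of $P$. An ultrametric is a finite space $U$ with a distance $d_U:U\times U\to[0,\infty]$ that is symmetric, vanishes exactly on the diagonal, and satisfies $d_U(x,z)\le\max\{d_U(x,y),d_U(y,z)\}$. A clan embedding of $G$ into $U$ is a pair $(f,\chi)$, where $f$ assigns to the vertices of $G$ pairwise disjoint subsets $f(v)\subseteq U$, $\chi(v)\in f(v)$ for all $v$, and $d_G(u,v)\le\min_{u'\in f(u),v'\in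 f(v)}d_U(u',v')$ for all $u,v$. It has hop-distortion $(t,\beta,h)$ if for all $u,v\in V$ $$d_G^{(\beta h)}(u,v)\le\min_{u'\in f(u),v'\in f(v)}d_U(u',v')\quad\text{and}\quad \min_{v'\in f(v)}d_U(v',\chi(u))\le t\cdot d_G^{(h)}(u,v).$$ It has hop-path-distortion $(t,h)$ if for every $h$-respecting path $(v_0,\dots,v_m)$ there are $v_i'\in f(v_i)$ with $\sum_{i=0}^{m-1}d_U(v_i',v_{i+1}')\le t\sum_{i=0}^{m-1}w(v_i,v_{i+1})$. (1) For every $k\in\{1,\dots,n\}$ there is a probability distribution $\mathcal D$ over clan embeddings $(f,\chi)$ of $G$ into ultrametrics such that every $(f,\chi)\in\mathrm{supp}(\mathcal D)$ has hop-distortion $(C k\log\log n,\ C k\log\log n,\ h)$ and hop-path-distortion $(C k\log n\log\log n,\ h)$, and $\mathbb E_{f\sim\mathcal D}[|f(v)|]\le C n^{1/k}$ for every $v\in V$. (2) For every $\epsilon\in(0,1)$ there is a probability distribution $\mathcal D$ over clan embeddings $(f,\chi)$ of $G$ into ultrametrics such that every $(f,\chi)\in\mathrm{supp}(\mathcal D)$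 has hop-distortion $\left(C\frac{\log n\log\log n}{\epsilon},\ C\frac{\log n\log\log n}{\epsilon},\ h\right)$ and hop-path-distortion $\left(C\frac{\log^2 n\log\log n}{\epsilon},\ h\right)$, and $\mathbb E_{f\sim\mathcal D}[|f(v)|]\le 1+\epsilon$ for every $v\in V$. -/

import Mathlib

open scoped NNReal ENNReal

namespace HopClan

universe u

variable {V : Type u}

/-- The weight of a walk `v₀, v₁, …, v_m`: the sum of the weights of its `m` steps, counted with
multiplicity. Only the values of `w` on edges of the graph matter. -/
def walkWeight {G : SimpleGraph V} (w : Sym2 V → ℝ≥0) {a b : V} (p : G.Walk a b) : ℝ≥0 :=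
  (p.edges.map w).sum

/-- The shortest path distance `d_G(a, b)`, equal to `∞` if `a` and `b` are not connected. -/
noncomputable def graphDist (G : SimpleGraph V) (w : Sym2 V → ℝ≥0) (a b : V) : ℝ≥0∞ :=
  ⨅ p : G.Walk a b, (walkWeight w p : ℝ≥0∞)

/-- The hop-constrained distance `d_G^{(r)}(a, b)`: the least weight of a path from `a` to `b` with
at most `r` hops, equal to `∞` if there is none. The hop bound `r` may be any real number. -/
noncomputable def hopDist (G : SimpleGraph V) (w : Sym2 V → ℝ≥0) (r : ℝ) (a b : V) : ℝ≥0∞ :=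
  ⨅ (p : G.Walk a b) (_ : (p.length : ℝ) ≤ r), (walkWeight w p : ℝ≥0∞)

/-- The shortest path distance `d_H(a, b)` inside a subgraph `H` of `G`. -/
noncomputable def subgraphDist {G : SimpleGraph V} (w : Sym2 V → ℝ≥0) (H : G.Subgraph)
    (a b : V) : ℝ≥0∞ :=
  ⨅ (p : G.Walk a b) (_ : p.toSubgraph ≤ H), (walkWeight w p : ℝ≥0∞)

/-- A subgraph `H` of `G` is `h`-respecting if `d_G^{(h)}(a, b) ≤ d_H(a, b)` for all vertices
`a, b` of `H`. -/
def HopRespecting {G : SimpleGraph V} (w : Sym2 V → ℝ≥0) (h : ℕ) (H : G.Subgraph) : Prop :=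
  ∀ a ∈ H.verts, ∀ b ∈ H.verts, hopDist G w h a b ≤ subgraphDist w H a b

/-- A clan embedding of the weighted graph `(G, w)` into a finite ultrametric. Distances in the
ultrametric may be infinite: the labels of the corresponding tree lie in `[0, ∞]`. -/
structure ClanEmbedding (G : SimpleGraph V) (w : Sym2 V → ℝ≥0) where
  /-- the points of the ultrametric -/
  Point : Type
  /-- there are finitely many points -/
  finite_point : Finite Point
  /-- the distance of the ultrametric -/
  emetric : EMetricSpace Point
  /-- the strong triangle inequality -/
  ultra : ∀ x y z : Point, edist x z ≤ max (edist x y) (edist y z)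
  /-- the one-to-many embedding `f`: `clan v` is the set of copies of `v` -/
  clan : V → Finset Point
  /-- the chief `χ(v)` of the clan of `v` -/
  chief : V → Point
  /-- the chief is one of the copies; in particular clans are non-empty -/
  chief_mem : ∀ v, chief v ∈ clan v
  /-- the clans are disjoint -/
  clan_disjoint : ∀ a b, a ≠ b → Disjoint (clan a) (clan b)
  /-- the one-to-many embedding is dominating -/
  dominating : ∀ a b, ∀ x ∈ clan a, ∀ y ∈ clan b, graphDist G w a b ≤ edist x y

attribute [instance] ClanEmbedding.emetric

namespace ClanEmbedding

variable {G : SimpleGraph V} {w : Sym2 V → ℝ≥0}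

/-- The clan embedding `(f, χ)` has hop-distortion `(t, β, h)`: for all vertices `a, b`,
`d_G^{(β h)}(a, b) ≤ min_{x ∈ f(a), y ∈ f(b)} d(x, y)` and
`min_{x ∈ f(a)} d(x, χ(b)) ≤ t · d_G^{(h)}(a, b)`. -/
def HasHopDistortion (F : ClanEmbedding G w) (t β : ℝ) (h : ℕ) : Prop :=
  ∀ a b : V,
    (∀ x ∈ F.clan a, ∀ y ∈ F.clan b, hopDist G w (β * h) a b ≤ edist x y) ∧
    (∃ x ∈ F.clan a, edist x (F.chief b) ≤ ENNReal.ofReal t * hopDist G w h a b)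

/-- The one-to-many embedding `f` has hop-path-distortion `(t, h)`: for every (not necessarily
simple) `h`-respecting path `v₀, …, v_m` there are copies `xᵢ ∈ f(vᵢ)` such that
`∑ d(xᵢ, xᵢ₊₁) ≤ t · ∑ w(vᵢ, vᵢ₊₁)`. -/
def HasHopPathDistortion (F : ClanEmbedding G w) (t : ℝ) (h : ℕ) : Prop :=
  ∀ (a b : V) (p : G.Walk a b), HopRespecting w h p.toSubgraph →
    ∃ x : ℕ → F.Point, (∀ i ≤ p.length, x i ∈ F.clan (p.getVert i)) ∧
      ∑ i ∈ Finset.range p.length, edist (x i) (x (i + 1)) ≤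
        ENNReal.ofReal t * (walkWeight w p : ℝ≥0∞)

end ClanEmbedding

/-- The expected number `E_{f ∼ D} |f(v)|` of copies of `v` in a random clan embedding. -/
noncomputable def expectedClanSize {G : SimpleGraph V} {w : Sym2 V → ℝ≥0}
    (D : PMF (ClanEmbedding G w)) (v : V) : ℝ≥0∞ :=
  ∑' F : ClanEmbedding G w, D F * ((F.clan v).card : ℝ≥0∞)

end HopClan

namespace HopClan

universe u

/-! The embedding is built by recursive ball growing with overlap. Take `h` hops as the unit of hops
and weight the vertices by a measure `μ ≥ 1`. `HopDistance.exists_split` covers a set `A` of `R`-hop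
diameter `D` by two proper subsets `S`, `T` such that every ball of radius `D / R` in the 1-unit
distance lies in one of them. Vertices in `S ∩ T` are duplicated, and the two recursive ultrametrics
are joined at distance `D`. The scale is the diameter of the current set, and the recursion is
controlled by `μ` alone, so neither aspect ratio nor connectivity matters (`D = ∞` is allowed).

Three invariants survive the join (`PartialClan.exists_partialClan`). The split satisfies
`μ(S)^(1+θ) + μ(T)^(1+θ) ≤ μ(A)^(1+θ)`, so the total measure of all copies is at most `μ(A)^(1+θ)`.
The chief of `v` goes to a side containing the ball around `v`, so any `u` separated from it is
already at distance at least `D / R`. Finally `μ(S) ≤ μ(A) / 2`: divided path edges are charged to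
edges touching the `S` side, so an edge is charged only logarithmically often.

This bounds an average clan size for each fixed measure. The minimax principle
`exists_pmf_of_forall_weight` turns it into one distribution that bounds every expected clan size.
Both claims are instances of `exists_clanDistribution`, with `θ = 1/k` and with `θ` of order `ε /
log n`. -/

/-! ### Sparse overlapping cuts by ball growing -/

/-- If every step fails, then `log (M / c i)` shrinks by a factor `1 + θ` per step below half mass,
and `log (M / (M - c i))` grows by that factor above it. Both quantities are at most `log N`, and at
least `log 2` on their own side, so neither phase lasts `s` steps. -/
theorem exists_sparse_cut_index {M N θ : ℝ} {s : ℕ} {c : ℕ → ℝ} (hθ : 0 < θ) (hMN : M ≤ N)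
    (hs : Real.log N < (1 + θ) ^ s * Real.log 2)
    (hc1 : ∀ i ≤ 2 * s, 1 ≤ c i) (hcM : ∀ i ≤ 2 * s, c i ≤ M - 1) (hc : Monotone c) :
    ∃ i < 2 * s, (c (i + 1) ≤ M / 2 ∧ c (i + 1) ^ (1 + θ) ≤ c i * M ^ θ) ∨
      (M / 2 ≤ c i ∧ (M - c i) ^ (1 + θ) ≤ (M - c (i + 1)) * M ^ θ) := by
  have hM : 0 < M := by linarith [hc1 0 (by omega), hcM 0 (by omega)]
  have h1θ : 0 < 1 + θ := by linarith
  have key : ∀ x y : ℝ, 0 < x → 0 < y → y * M ^ θ < x ^ (1 + θ) →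
      (1 + θ) * Real.log (M / x) < Real.log (M / y) := by
    intro x y hx hy h
    have h' := Real.log_lt_log (by positivity) h
    rw [Real.log_mul hy.ne' (by positivity), Real.log_rpow hx, Real.log_rpow hM] at h'
    rw [Real.log_div hM.ne' hx.ne', Real.log_div hM.ne' hy.ne']
    linarith
  have hN : ∀ x : ℝ, 1 ≤ x → Real.log (M / x) ≤ Real.log N := by
    intro x hx
    apply Real.log_le_log (by positivity)
    exact (div_le_self hM.le hx).trans hMN
  have h2 : ∀ x : ℝ, 0 < x → x ≤ M / 2 → Real.log 2 ≤ Real.log (M / x) := by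
    intro x hx h
    apply Real.log_le_log (by norm_num)
    rw [le_div_iff₀ hx]
    linarith
  by_contra! hcon
  -- By monotonicity, either the first `s` steps all lie below half mass or the last `s` all lie
  -- above it.
  by_cases hhalf : c s ≤ M / 2
  · have ind : ∀ i ≤ s, (1 + θ) ^ i * Real.log (M / c i) ≤ Real.log N := by
      intro i
      induction i with
      | zero => intro _; simpa using hN _ (hc1 0 (by omega))
      | succ i ih =>
        intro hi
        have h0 := hc1 i (by omega)
        have h1 := hc1 (i + 1) (by omega)
        have h3 := key (c (i + 1)) (c i) (by linarith) (by linarith)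
          ((hcon i (by omega)).1 ((hc hi).trans hhalf))
        calc (1 + θ) ^ (i + 1) * Real.log (M / c (i + 1))
            = (1 + θ) ^ i * ((1 + θ) * Real.log (M / c (i + 1))) := by ring
          _ ≤ (1 + θ) ^ i * Real.log (M / c i) := by gcongr
          _ ≤ _ := ih (by omega)
    have h3 := ind s le_rfl
    have h4 := h2 (c s) (by linarith [hc1 s (by omega)]) hhalf
    have : (1 + θ) ^ s * Real.log 2 ≤ (1 + θ) ^ s * Real.log (M / c s) := by gcongr
    linarith
  · push Not at hhalf
    have ind : ∀ i ≤ s, (1 + θ) ^ i * Real.log 2 ≤ Real.log (M / (M - c (s + i))) := by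
      intro i
      induction i with
      | zero =>
        intro _
        simpa using h2 (M - c s) (by linarith [hcM s (by omega)]) (by linarith)
      | succ i ih =>
        intro hi
        have h0 := hcM (s + i) (by omega)
        have h1 := hcM (s + i + 1) (by omega)
        have h3 := key (M - c (s + i)) (M - c (s + i + 1)) (by linarith) (by linarith)
          ((hcon (s + i) (by omega)).2 (hhalf.le.trans (hc (by omega))))
        calc (1 + θ) ^ (i + 1) * Real.log 2
            = (1 + θ) * ((1 + θ) ^ i * Real.log 2) := by ring
          _ ≤ (1 + θ) * Real.log (M / (M - c (s + i))) := by gcongr; exact ih (by omega)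
          _ ≤ _ := h3.le
    have h3 := ind s le_rfl
    have h4 := hN (M - c (s + s)) (by linarith [hcM (s + s) (by omega)])
    linarith

/-- A family of hop-constrained distances: `dist j a b` is the distance from `a` to `b` with a
budget of `j` units of hops. -/
structure HopDistance (V : Type u) where
  dist : ℕ → V → V → ℝ≥0∞
  self : ∀ j a, dist j a a = 0
  symm : ∀ j a b, dist j a b = dist j b a
  triangle : ∀ i j a b c, dist (i + j) a c ≤ dist i a b + dist j b c
  pos : ∀ j a b, a ≠ b → 0 < dist j a b

namespace HopDistance

variable {V : Type u} (δ : HopDistance V)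

theorem anti {i j : ℕ} (h : i ≤ j) (a b : V) : δ.dist j a b ≤ δ.dist i a b := by
  obtain ⟨k, rfl⟩ := Nat.exists_eq_add_of_le h
  simpa [δ.self] using δ.triangle i k a b b

/-- The diameter of a finite set with respect to the `R`-hop distance. -/
noncomputable def diam (R : ℕ) (A : Finset V) : ℝ≥0∞ := A.sup fun a => A.sup fun b => δ.dist R a b

theorem dist_le_diam {R : ℕ} {A : Finset V} {a b : V} (ha : a ∈ A) (hb : b ∈ A) :
    δ.dist R a b ≤ δ.diam R A :=
  (Finset.le_sup (f := fun b => δ.dist R a b) hb).trans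
    (Finset.le_sup (f := fun a => A.sup fun b => δ.dist R a b) ha)

theorem diam_mono {R : ℕ} {A B : Finset V} (h : A ⊆ B) : δ.diam R A ≤ δ.diam R B :=
  Finset.sup_le fun _ ha => Finset.sup_le fun _ hb => δ.dist_le_diam (h ha) (h hb)

theorem diam_pos {R : ℕ} {A : Finset V} (hA : A.Nontrivial) : 0 < δ.diam R A := by
  obtain ⟨a, ha, b, hb, hab⟩ := hA
  exact (δ.pos R a b hab).trans_le (δ.dist_le_diam ha hb)

theorem diam_lt {R : ℕ} {A : Finset V} {D : ℝ≥0∞} (hD : 0 < D)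
    (h : ∀ a ∈ A, ∀ b ∈ A, δ.dist R a b < D) : δ.diam R A < D :=
  (Finset.sup_lt_iff hD).2 fun a ha => (Finset.sup_lt_iff hD).2 fun b hb => h a ha b hb

-- Balls grow around a centre in steps of radius `r = D / R`, each step also adding one unit of
-- hops. The two sides are an outer ball and the complement of the ball two steps smaller.
-- `exists_sparse_cut_index` picks the radius; the side of at most half the mass is called `S`.
open Classical in
theorem exists_split {θ N : ℝ} {s R : ℕ} (hθ : 0 < θ) (hs : Real.log N < (1 + θ) ^ s * Real.log 2)
    (hR : 8 * s + 2 ≤ R) {μ : V → ℝ} (hμ : ∀ v, 1 ≤ μ v) {A : Finset V} (hA : A.Nontrivial)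
    (hAN : ∑ v ∈ A, μ v ≤ N) :
    ∃ S T : Finset V, S ⊂ A ∧ T ⊂ A ∧ S ∪ T = A ∧ ∑ v ∈ S, μ v ≤ (∑ v ∈ A, μ v) / 2 ∧
      (∑ v ∈ S, μ v) ^ (1 + θ) + (∑ v ∈ T, μ v) ^ (1 + θ) ≤ (∑ v ∈ A, μ v) ^ (1 + θ) ∧
      ∀ v ∈ A, (∀ u ∈ A, δ.dist 1 u v < δ.diam R A / R → u ∈ S) ∨
        (∀ u ∈ A, δ.dist 1 u v < δ.diam R A / R → u ∈ T) := by
  set D := δ.diam R A with hD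
  set r := D / R with hr
  have hD0 : 0 < D := δ.diam_pos hA
  have hR0 : (R : ℝ≥0∞) ≠ 0 := by simp; omega
  have hr0 : 0 < r := ENNReal.div_pos hD0.ne' (by simp)
  have hrR : (R : ℝ≥0∞) * r = D := ENNReal.mul_div_cancel hR0 (by simp)
  obtain ⟨c, hcA⟩ := hA.nonempty
  set M := ∑ v ∈ A, μ v with hM
  have hμ0 : ∀ v, 0 ≤ μ v := fun v => by linarith [hμ v]
  -- `B 0` is empty because the inequality is strict, so the cuts use the odd indices `2 * i + 1`.
  -- The largest one is `4 * s + 1`, and twice it is the bound `8 * s + 2 ≤ R` that keeps the ball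
  -- different from `A`.
  let B : ℕ → Finset V := fun j => A.filter fun u => δ.dist j c u < j * r
  have hBA : ∀ j, B j ⊆ A := fun j => Finset.filter_subset _ _
  have hstep : ∀ j u v, u ∈ A → v ∈ B j → δ.dist 1 u v < r → u ∈ B (j + 1) := by
    intro j u v hu hv huv
    simp only [B, Finset.mem_filter] at hv ⊢
    refine ⟨hu, (δ.triangle j 1 c v u).trans_lt ?_⟩
    rw [δ.symm 1 v u]
    push_cast
    rw [add_mul, one_mul]
    exact ENNReal.add_lt_add hv.2 huv
  have hmono : Monotone B := by
    refine monotone_nat_of_le_succ fun j u hu => hstep j u u (hBA j hu) hu ?_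
    rw [δ.self]; exact hr0
  have hcB : ∀ j, 1 ≤ j → c ∈ B j := by
    intro j hj
    simp only [B, Finset.mem_filter, δ.self]
    refine ⟨hcA, ENNReal.mul_pos (by simp; omega) hr0.ne'⟩
  have hBne : ∀ j, 2 * j ≤ R → B j ≠ A := by
    intro j hj h
    refine lt_irrefl D ?_
    conv_lhs => rw [hD]
    refine δ.diam_lt hD0 fun a ha b hb => ?_
    rw [← h] at ha hb
    simp only [B, Finset.mem_filter] at ha hb
    calc δ.dist R a b ≤ δ.dist (j + j) a b := δ.anti (by omega) a b
      _ ≤ δ.dist j a c + δ.dist j c b := δ.triangle j j a c b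
      _ < j * r + j * r := ENNReal.add_lt_add (by rw [δ.symm]; exact ha.2) hb.2
      _ = ((2 * j : ℕ) : ℝ≥0∞) * r := by push_cast; ring
      _ ≤ R * r := by gcongr
      _ = D := hrR
  let m : ℕ → ℝ := fun i => ∑ v ∈ B (2 * i + 1), μ v
  have hsdiff : ∀ j, ∑ v ∈ A \ B j, μ v = M - ∑ v ∈ B j, μ v := by
    intro j
    rw [hM, ← Finset.sum_sdiff (hBA j)]
    ring
  have hone : ∀ X : Finset V, X.Nonempty → 1 ≤ ∑ v ∈ X, μ v := by
    rintro X ⟨x, hx⟩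
    exact (hμ x).trans (Finset.single_le_sum (fun v _ => hμ0 v) hx)
  have hm1 : ∀ i, 1 ≤ m i := fun i => hone _ ⟨c, hcB _ (by omega)⟩
  have hmM : ∀ i ≤ 2 * s, m i ≤ M - 1 := by
    intro i hi
    have h1 : (A \ B (2 * i + 1)).Nonempty := by
      rw [Finset.sdiff_nonempty]
      intro h
      exact hBne _ (by omega) ((hBA _).antisymm h)
    have h2 := hone _ h1
    rw [hsdiff] at h2
    simp only [m]
    linarith
  have hmm : Monotone m := fun i j hij =>
    Finset.sum_le_sum_of_subset_of_nonneg (hmono (by omega)) fun v _ _ => hμ0 v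
  have hM0 : 0 < M := by linarith [hm1 0, hmM 0 (by omega)]
  have hpow : ∀ x, 0 ≤ x → x ≤ M → x ^ (1 + θ) ≤ x * M ^ θ := by
    intro x hx hxM
    rw [Real.rpow_add_of_nonneg hx (by norm_num) hθ.le, Real.rpow_one]
    gcongr
  have hMpow : M ^ (1 + θ) = M * M ^ θ := by rw [Real.rpow_add hM0, Real.rpow_one]
  obtain ⟨i, hi, hcase⟩ := exists_sparse_cut_index hθ hAN hs (fun i _ => hm1 i) hmM hmm
  have hP : B (2 * (i + 1) + 1) ⊂ A :=
    Finset.ssubset_iff_subset_ne.2 ⟨hBA _, hBne _ (by omega)⟩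
  have hQ : A \ B (2 * i + 1) ⊂ A :=
    Finset.sdiff_ssubset (hBA _) ⟨c, hcB _ (by omega)⟩
  have hunion : B (2 * (i + 1) + 1) ∪ A \ B (2 * i + 1) = A := by
    ext v
    simp only [Finset.mem_union, Finset.mem_sdiff]
    constructor
    · rintro (h | h)
      exacts [hBA _ h, h.1]
    · intro h
      by_cases hv : v ∈ B (2 * i + 1)
      · exact Or.inl (hmono (by omega) hv)
      · exact Or.inr ⟨h, hv⟩
  -- The intermediate ball `B (2 * i + 2)` decides: one step out from inside it stays in the outer
  -- ball, and one step from outside it cannot reach the inner ball.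
  have hball : ∀ v ∈ A, (∀ u ∈ A, δ.dist 1 u v < r → u ∈ B (2 * (i + 1) + 1)) ∨
      (∀ u ∈ A, δ.dist 1 u v < r → u ∈ A \ B (2 * i + 1)) := by
    intro v hv
    by_cases h : v ∈ B (2 * i + 1 + 1)
    · exact Or.inl fun u hu huv => hstep _ u v hu h huv
    · refine Or.inr fun u hu huv => Finset.mem_sdiff.2 ⟨hu, fun hu' => h ?_⟩
      exact hstep _ v u hv hu' (by rwa [δ.symm])
  have e1 := hsdiff (2 * i + 1)
  have a0 := hm1 i
  have a1 := hm1 (i + 1)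
  have b0 := hmM i (by omega)
  have b1 := hmM (i + 1) (by omega)
  rcases hcase with ⟨h1, h2⟩ | ⟨h1, h2⟩
  · refine ⟨_, _, hP, hQ, hunion, h1, ?_, hball⟩
    rw [e1, hMpow]
    have h3 := hpow (M - m i) (by linarith) (by linarith)
    simp only [m] at h2 h3 ⊢
    linarith
  · refine ⟨_, _, hQ, hP, by rw [Finset.union_comm]; exact hunion, ?_, ?_,
      fun v hv => (hball v hv).symm⟩
    · rw [e1]
      simp only [m] at h1
      linarith
    · rw [e1, hMpow]
      have h3 := hpow (m (i + 1)) (by linarith) (by linarith)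
      simp only [m] at h2 h3 ⊢
      linarith

end HopDistance

/-! ### Dividing paths between the two sides of a cut -/

theorem card_mul_le_sum_of_disjoint {X Z : Finset ℕ} {Y : ℕ → Finset ℕ} {ω : ℕ → ℝ≥0∞} {r : ℝ≥0∞}
    (hY : ∀ i ∈ X, Y i ⊆ Z) (hr : ∀ i ∈ X, r ≤ ∑ l ∈ Y i, ω l)
    (hd : ∀ i ∈ X, ∀ j ∈ X, i < j → Disjoint (Y i) (Y j)) :
    (X.card : ℝ≥0∞) * r ≤ ∑ l ∈ Z, ω l := by
  have hd' : (X : Set ℕ).PairwiseDisjoint Y := by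
    intro i hi j hj hij
    rcases lt_or_gt_of_ne hij with h | h
    exacts [hd i hi j hj h, (hd j hj i hi h).symm]
  calc (X.card : ℝ≥0∞) * r = ∑ i ∈ X, r := by simp
    _ ≤ ∑ i ∈ X, ∑ l ∈ Y i, ω l := Finset.sum_le_sum hr
    _ = ∑ l ∈ X.biUnion Y, ω l := (Finset.sum_biUnion hd').symm
    _ ≤ _ := Finset.sum_le_sum_of_subset (Finset.biUnion_subset.2 hY)

open Classical in
/-- A union of paths, with vertex indices `I` and edge indices `E`, inside `S ∪ T` can be divided
between `S` and `T` so that the number of divided edges is controlled by the weight of the edges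
that are divided or on the side of `S`. -/
theorem exists_path_division {V : Type u} {S T : Finset V} {q : ℕ → V} {ω : ℕ → ℝ≥0∞} {r : ℝ≥0∞}
    {I E : Finset ℕ} (hE : ∀ i ∈ E, i ∈ I ∧ i + 1 ∈ I) (hI : ∀ i ∈ I, q i ∈ S ∨ q i ∈ T)
    (hcross : ∀ i j, i < j → Finset.Ico i j ⊆ E →
      (q i ∉ S ∧ q j ∉ T) ∨ (q i ∉ T ∧ q j ∉ S) → r ≤ ∑ l ∈ Finset.Ico i j, ω l) :
    ∃ J ⊆ I, (∀ i ∈ J, q i ∈ S) ∧ (∀ i ∈ I, i ∉ J → q i ∈ T) ∧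
      ((E.filter fun i => ¬(i ∈ J ↔ i + 1 ∈ J)).card : ℝ≥0∞) * r ≤
        2 * ∑ i ∈ E with (i ∈ J ∨ i + 1 ∈ J), ω i := by
  let conn : ℕ → ℕ → Prop := fun a b => Finset.Ico a b ⊆ E ∧ ∀ l, a ≤ l → l ≤ b → q l ∈ S
  -- Only what is forced goes to `S`: the indices joined, by a run of path edges inside `S`, to a
  -- vertex missing from `T`. A divided edge then has an endpoint outside `S`, since otherwise the
  -- run would extend across it.
  let J := I.filter fun i => ∃ j, q j ∉ T ∧ ((i ≤ j ∧ conn i j) ∨ (j ≤ i ∧ conn j i))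
  have hJI : J ⊆ I := Finset.filter_subset _ _
  have hJS : ∀ i ∈ J, q i ∈ S := by
    intro i hi
    obtain ⟨_, j, _, ⟨h, h'⟩ | ⟨h, h'⟩⟩ := Finset.mem_filter.1 hi
    exacts [h'.2 i le_rfl h, h'.2 i h le_rfl]
  have hJT : ∀ i ∈ I, i ∉ J → q i ∈ T := by
    intro i hi hiJ
    by_contra hT
    have hS : q i ∈ S := (hI i hi).resolve_right hT
    refine hiJ (Finset.mem_filter.2 ⟨hi, i, hT, Or.inl ⟨le_rfl, by simp, fun l h1 h2 => ?_⟩⟩)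
    rwa [le_antisymm h2 h1]
  have hright : ∀ i ∈ E, i ∉ J → i + 1 ∈ J → q i ∉ S ∧ ∃ j, i + 1 ≤ j ∧ q j ∉ T ∧ conn (i + 1) j := by
    intro i hi h0 h1
    obtain ⟨_, j, hj, hc⟩ := Finset.mem_filter.1 h1
    have hS : q i ∉ S := by
      intro hS
      refine h0 (Finset.mem_filter.2 ⟨(hE i hi).1, j, hj, ?_⟩)
      rcases hc with ⟨h2, h3, h4⟩ | ⟨h2, h3, h4⟩
      · refine Or.inl ⟨by omega, fun l hl => ?_, fun l hl hl' => ?_⟩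
        · rcases eq_or_ne l i with rfl | hne
          · exact hi
          · rw [Finset.mem_Ico] at hl
            exact h3 (Finset.mem_Ico.2 ⟨by omega, hl.2⟩)
        · rcases eq_or_ne l i with rfl | hne
          · exact hS
          · exact h4 l (by omega) hl'
      · rcases Nat.lt_or_ge i j with h5 | h5
        · obtain rfl : j = i + 1 := by omega
          refine Or.inl ⟨by omega, by simpa using hi, fun l hl hl' => ?_⟩
          rcases eq_or_ne l i with rfl | hne
          · exact hS
          · exact h4 l (by omega) hl'
        · exact Or.inr ⟨h5, (Finset.Ico_subset_Ico_right (by omega)).trans h3,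
            fun l hl hl' => h4 l hl (by omega)⟩
    refine ⟨hS, j, ?_⟩
    rcases hc with ⟨h2, h3⟩ | ⟨h2, h3⟩
    · exact ⟨h2, hj, h3⟩
    · rcases Nat.lt_or_ge i j with h5 | h5
      · obtain rfl : j = i + 1 := by omega
        exact ⟨le_rfl, hj, h3⟩
      · exact absurd (h3.2 i h5 (by omega)) hS
  have hleft : ∀ i ∈ E, i ∈ J → i + 1 ∉ J → q (i + 1) ∉ S ∧ ∃ j, j ≤ i ∧ q j ∉ T ∧ conn j i := by
    intro i hi h1 h0
    obtain ⟨_, j, hj, hc⟩ := Finset.mem_filter.1 h1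
    have hS : q (i + 1) ∉ S := by
      intro hS
      refine h0 (Finset.mem_filter.2 ⟨(hE i hi).2, j, hj, ?_⟩)
      rcases Nat.lt_or_ge i j with h5 | h5
      · rcases hc with ⟨h2, h3, h4⟩ | ⟨h2, h3, h4⟩
        · exact Or.inl ⟨h5, (Finset.Ico_subset_Ico_left (by omega)).trans h3,
            fun l hl hl' => h4 l (by omega) hl'⟩
        · omega
      · have hc' : conn j i := by
          rcases hc with ⟨h2, h3⟩ | ⟨h2, h3⟩
          · obtain rfl : i = j := by omega
            exact h3
          · exact h3
        refine Or.inr ⟨by omega, fun l hl => ?_, fun l hl hl' => ?_⟩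
        · rcases eq_or_ne l i with rfl | hne
          · exact hi
          · rw [Finset.mem_Ico] at hl
            exact hc'.1 (Finset.mem_Ico.2 ⟨hl.1, by omega⟩)
        · rcases eq_or_ne l (i + 1) with rfl | hne
          · exact hS
          · exact hc'.2 l hl (by omega)
    refine ⟨hS, j, ?_⟩
    rcases hc with ⟨h2, h3⟩ | ⟨h2, h3⟩
    · rcases Nat.lt_or_ge i j with h5 | h5
      · exact absurd (h3.2 (i + 1) (by omega) h5) hS
      · obtain rfl : i = j := by omega
        exact ⟨le_rfl, hj, h3⟩
    · exact ⟨h2, hj, h3⟩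
  refine ⟨J, hJI, hJS, hJT, ?_⟩
  set Z := E.filter fun i => i ∈ J ∨ i + 1 ∈ J with hZ
  -- Each edge entering `J` starts a stretch from a vertex outside `S` to one outside `T`, of weight
  -- at least `r`. Stretches are disjoint: each stays in `S` after its first vertex, while the next
  -- begins outside `S`. Edges leaving `J` are symmetric, whence the factor 2.
  have hR : ((E.filter fun i => i ∉ J ∧ i + 1 ∈ J).card : ℝ≥0∞) * r ≤ ∑ l ∈ Z, ω l := by
    have hex : ∀ i ∈ E.filter (fun i => i ∉ J ∧ i + 1 ∈ J),
        ∃ j, q i ∉ S ∧ i + 1 ≤ j ∧ q j ∉ T ∧ conn (i + 1) j ∧ Finset.Ico i j ⊆ E := by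
      intro i hi
      obtain ⟨hiE, h0, h1⟩ := Finset.mem_filter.1 hi
      obtain ⟨hS, j, hj, hT, hc⟩ := hright i hiE h0 h1
      refine ⟨j, hS, hj, hT, hc, fun l hl => ?_⟩
      rcases eq_or_ne l i with rfl | hne
      · exact hiE
      · rw [Finset.mem_Ico] at hl
        exact hc.1 (Finset.mem_Ico.2 ⟨by omega, hl.2⟩)
    choose! g hgS hgi hgT hgc hgE using hex
    refine card_mul_le_sum_of_disjoint (Y := fun i => Finset.Ico i (g i)) ?_ ?_ ?_
    · intro i hi l hl
      have hlE := hgE i hi hl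
      have hc := hgc i hi
      rw [Finset.mem_Ico] at hl
      refine Finset.mem_filter.2 ⟨hlE, Or.inr (Finset.mem_filter.2 ⟨(hE l hlE).2, g i, hgT i hi,
        Or.inl ⟨hl.2, (Finset.Ico_subset_Ico_left (by omega)).trans hc.1,
          fun m hm hm' => hc.2 m (by omega) hm'⟩⟩)⟩
    · intro i hi
      exact hcross i (g i) (hgi i hi) (hgE i hi) (Or.inl ⟨hgS i hi, hgT i hi⟩)
    · intro i hi j hj hij
      rw [Finset.disjoint_left]
      intro l hl hl'
      simp only [Finset.mem_Ico] at hl hl'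
      exact hgS j hj ((hgc i hi).2 j (by omega) (by omega))
  have hL : ((E.filter fun i => i ∈ J ∧ i + 1 ∉ J).card : ℝ≥0∞) * r ≤ ∑ l ∈ Z, ω l := by
    have hex : ∀ i ∈ E.filter (fun i => i ∈ J ∧ i + 1 ∉ J),
        ∃ j, q (i + 1) ∉ S ∧ j ≤ i ∧ q j ∉ T ∧ conn j i ∧ Finset.Ico j (i + 1) ⊆ E := by
      intro i hi
      obtain ⟨hiE, h0, h1⟩ := Finset.mem_filter.1 hi
      obtain ⟨hS, j, hj, hT, hc⟩ := hleft i hiE h0 h1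
      refine ⟨j, hS, hj, hT, hc, fun l hl => ?_⟩
      rcases eq_or_ne l i with rfl | hne
      · exact hiE
      · rw [Finset.mem_Ico] at hl
        exact hc.1 (Finset.mem_Ico.2 ⟨hl.1, by omega⟩)
    choose! g hgS hgi hgT hgc hgE using hex
    refine card_mul_le_sum_of_disjoint (Y := fun i => Finset.Ico (g i) (i + 1)) ?_ ?_ ?_
    · intro i hi l hl
      have hlE := hgE i hi hl
      have hc := hgc i hi
      rw [Finset.mem_Ico] at hl
      refine Finset.mem_filter.2 ⟨hlE, Or.inl (Finset.mem_filter.2 ⟨(hE l hlE).1, g i, hgT i hi,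
        Or.inr ⟨hl.1, (Finset.Ico_subset_Ico_right (by omega)).trans hc.1,
          fun m hm hm' => hc.2 m hm (by omega)⟩⟩)⟩
    · intro i hi
      exact hcross (g i) (i + 1) (by have := hgi i hi; omega) (hgE i hi)
        (Or.inr ⟨hgT i hi, hgS i hi⟩)
    · intro i hi j hj hij
      rw [Finset.disjoint_left]
      intro l hl hl'
      simp only [Finset.mem_Ico] at hl hl'
      exact hgS i hi ((hgc j hj).2 (i + 1) (by omega) (by omega))
  have hcard : (E.filter fun i => ¬(i ∈ J ↔ i + 1 ∈ J)).card ≤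
      (E.filter fun i => i ∉ J ∧ i + 1 ∈ J).card + (E.filter fun i => i ∈ J ∧ i + 1 ∉ J).card := by
    refine (Finset.card_le_card ?_).trans (Finset.card_union_le _ _)
    intro i hi
    simp only [Finset.mem_filter, Finset.mem_union] at hi ⊢
    tauto
  calc ((E.filter fun i => ¬(i ∈ J ↔ i + 1 ∈ J)).card : ℝ≥0∞) * r
      ≤ ((E.filter fun i => i ∉ J ∧ i + 1 ∈ J).card +
          (E.filter fun i => i ∈ J ∧ i + 1 ∉ J).card : ℝ≥0∞) * r := by
        gcongr; exact_mod_cast hcard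
    _ ≤ _ := by rw [add_mul, two_mul]; exact add_le_add hR hL

/-! ### Partial clan embeddings and their joins -/

/-- A one-to-many embedding of a finite set `A` into a finite ultrametric whose distances lie
between the `R`-hop distance and the `R`-hop diameter of `A`. -/
structure PartialClan {V : Type u} (δ : HopDistance V) (R : ℕ) (A : Finset V) where
  Point : Type
  fintype : Fintype Point
  d : Point → Point → ℝ≥0∞
  label : Point → V
  chief : V → Point
  d_self : ∀ x, d x x = 0
  eq_of_d : ∀ x y, d x y = 0 → x = y
  d_symm : ∀ x y, d x y = d y x
  ultra : ∀ x y z, d x z ≤ max (d x y) (d y z)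
  label_mem : ∀ x, label x ∈ A
  label_chief : ∀ v ∈ A, label (chief v) = v
  d_le : ∀ x y, d x y ≤ δ.diam R A
  le_d : ∀ x y, δ.dist R (label x) (label y) ≤ d x y

attribute [instance] PartialClan.fintype

namespace PartialClan

variable {V : Type u} {δ : HopDistance V} {R : ℕ} {A S T : Finset V}

/-- The total measure of all copies. -/
noncomputable def size (X : PartialClan δ R A) (μ : V → ℝ) : ℝ := ∑ x, μ (X.label x)

/-- Every vertex `u` has a copy within distance `R · δ₁(u, v)` of the chief of `v`. -/
def CloseToChief (X : PartialClan δ R A) : Prop :=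
  ∀ u ∈ A, ∀ v ∈ A, ∃ x, X.label x = u ∧ X.d x (X.chief v) ≤ R * δ.dist 1 u v

/-- Every union of paths, with vertex indices `I` and edge indices `E`, on which the `1`-hop
distance is at most the weight has a copy of weight at most `2 R p` times its weight. -/
def PathBound (X : PartialClan δ R A) (p : ℕ) : Prop :=
  ∀ (I E : Finset ℕ) (q : ℕ → V) (ω : ℕ → ℝ≥0∞), (∀ i ∈ E, i ∈ I ∧ i + 1 ∈ I) →
    (∀ i ∈ I, q i ∈ A) →
    (∀ i j, i < j → Finset.Ico i j ⊆ E → δ.dist 1 (q i) (q j) ≤ ∑ l ∈ Finset.Ico i j, ω l) →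
    ∃ x : ℕ → X.Point, (∀ i ∈ I, X.label (x i) = q i) ∧
      ∑ i ∈ E, X.d (x i) (x (i + 1)) ≤ 2 * R * p * ∑ i ∈ E, ω i

/-- The embedding of a single vertex. -/
def single (δ : HopDistance V) (R : ℕ) (c : V) : PartialClan δ R {c} where
  Point := Unit
  fintype := inferInstance
  d _ _ := 0
  label _ := c
  chief _ := ()
  d_self _ := rfl
  eq_of_d _ _ _ := rfl
  d_symm _ _ := rfl
  ultra _ _ _ := by simp
  label_mem _ := by simp
  label_chief v hv := by simpa using (Finset.mem_singleton.1 hv).symm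
  d_le _ _ := by simp
  le_d _ _ := by simp [δ.self]

open Classical in
/-- The union of two embeddings at distance `diam A`, with chiefs of `P` in the first one. -/
noncomputable def join (X : PartialClan δ R S) (Y : PartialClan δ R T) (hS : S ⊆ A) (hT : T ⊆ A)
    (hA : 0 < δ.diam R A) (P : Set V) (hPS : ∀ v ∈ A, v ∈ P → v ∈ S)
    (hPT : ∀ v ∈ A, v ∉ P → v ∈ T) : PartialClan δ R A where
  Point := X.Point ⊕ Y.Point
  fintype := inferInstance
  d x y := match x, y with
    | .inl x, .inl y => X.d x y
    | .inr x, .inr y => Y.d x y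
    | _, _ => δ.diam R A
  label := Sum.elim X.label Y.label
  chief v := if v ∈ P then .inl (X.chief v) else .inr (Y.chief v)
  d_self := by
    rintro (x | x)
    exacts [X.d_self x, Y.d_self x]
  eq_of_d := by
    rintro (x | x) (y | y) h
    · rw [X.eq_of_d x y h]
    · exact absurd h hA.ne'
    · exact absurd h hA.ne'
    · rw [Y.eq_of_d x y h]
  d_symm := by
    rintro (x | x) (y | y)
    exacts [X.d_symm x y, rfl, rfl, Y.d_symm x y]
  ultra := by
    rintro (x | x) (y | y) (z | z)
    · exact X.ultra x y z
    · exact le_max_right _ _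
    · exact ((X.d_le x z).trans (δ.diam_mono hS)).trans (le_max_left _ _)
    · exact le_max_left _ _
    · exact le_max_left _ _
    · exact ((Y.d_le x z).trans (δ.diam_mono hT)).trans (le_max_left _ _)
    · exact le_max_right _ _
    · exact Y.ultra x y z
  label_mem := by
    rintro (x | x)
    exacts [hS (X.label_mem x), hT (Y.label_mem x)]
  label_chief v hv := by
    by_cases h : v ∈ P
    · simpa [h] using X.label_chief v (hPS v hv h)
    · simpa [h] using Y.label_chief v (hPT v hv h)
  d_le := by
    rintro (x | x) (y | y)
    · exact (X.d_le x y).trans (δ.diam_mono hS)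
    · exact le_rfl
    · exact le_rfl
    · exact (Y.d_le x y).trans (δ.diam_mono hT)
  le_d := by
    rintro (x | x) (y | y)
    · exact X.le_d x y
    · exact δ.dist_le_diam (hS (X.label_mem x)) (hT (Y.label_mem y))
    · exact δ.dist_le_diam (hT (Y.label_mem x)) (hS (X.label_mem y))
    · exact Y.le_d x y

section Join

variable {X : PartialClan δ R S} {Y : PartialClan δ R T} {hS : S ⊆ A} {hT : T ⊆ A}
  {hA : 0 < δ.diam R A} {P : Set V} {hPS : ∀ v ∈ A, v ∈ P → v ∈ S} {hPT : ∀ v ∈ A, v ∉ P → v ∈ T}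

theorem size_join (μ : V → ℝ) :
    (X.join Y hS hT hA P hPS hPT).size μ = X.size μ + Y.size μ :=
  Fintype.sum_sum_type _

/-- Vertices closer than `D / R` to `v` have a copy on the side of the chief of `v`, so recursion
applies. For the others, the trivial bound `D = R * (D / R)` suffices. -/
theorem CloseToChief.join (hX : X.CloseToChief) (hY : Y.CloseToChief) (hR : R ≠ 0)
    (hP : ∀ v ∈ A, v ∈ P → ∀ u ∈ A, δ.dist 1 u v < δ.diam R A / R → u ∈ S)
    (hP' : ∀ v ∈ A, v ∉ P → ∀ u ∈ A, δ.dist 1 u v < δ.diam R A / R → u ∈ T) :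
    (X.join Y hS hT hA P hPS hPT).CloseToChief := by
  intro u hu v hv
  by_cases hd : δ.dist 1 u v < δ.diam R A / R
  · by_cases h : v ∈ P
    · obtain ⟨x, hx, hx'⟩ := hX u (hP v hv h u hu hd) v (hPS v hv h)
      refine ⟨Sum.inl x, hx, ?_⟩
      simpa [PartialClan.join, h] using hx'
    · obtain ⟨x, hx, hx'⟩ := hY u (hP' v hv h u hu hd) v (hPT v hv h)
      refine ⟨Sum.inr x, hx, ?_⟩
      simpa [PartialClan.join, h] using hx'
  · refine ⟨_, PartialClan.label_chief _ u hu, (PartialClan.d_le _ _ _).trans ?_⟩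
    rw [not_lt] at hd
    calc δ.diam R A = R * (δ.diam R A / R) := (ENNReal.mul_div_cancel (by simpa using hR) (by simp)).symm
      _ ≤ _ := by gcongr

-- Each divided edge costs `D = R * (D / R)`, and by `exists_path_division` the total is at most `2
-- * R` times the weight of the edges touching `J`. Edges inside `J` can afford this because the
-- bound on `S` has the smaller factor `p`; divided edges pay nothing else. Passing to pieces is why
-- `PathBound` speaks of unions of paths.
open Classical in
theorem PathBound.join {p : ℕ} (hX : X.PathBound p) (hY : Y.PathBound (p + 1)) (hR : R ≠ 0)
    (hST : S ∪ T = A)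
    (hcut : ∀ u ∈ A, ∀ v ∈ A, u ∉ S → v ∉ T → δ.diam R A / R ≤ δ.dist 1 u v) :
    (X.join Y hS hT hA P hPS hPT).PathBound (p + 1) := by
  intro I E q ω hE hq hω
  obtain ⟨J, hJI, hJS, hJT, hcard⟩ := exists_path_division (S := S) (T := T) (q := q) (ω := ω)
    (r := δ.diam R A / R) hE (fun i hi => by
      have := hq i hi
      rwa [← hST, Finset.mem_union] at this) (by
      intro i j hij hsub h
      refine le_trans ?_ (hω i j hij hsub)
      have hi : q i ∈ A := hq i (hE i (hsub (Finset.mem_Ico.2 ⟨le_rfl, hij⟩))).1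
      have hj : q j ∈ A := by
        have := hq _ (hE (j - 1) (hsub (Finset.mem_Ico.2 ⟨by omega, by omega⟩))).2
        rwa [Nat.sub_add_cancel (by omega)] at this
      rcases h with ⟨h1, h2⟩ | ⟨h1, h2⟩
      · exact hcut _ hi _ hj h1 h2
      · rw [δ.symm]
        exact hcut _ hj _ hi h2 h1)
  set EJ := E.filter fun i => i ∈ J ∧ i + 1 ∈ J with hEJ
  set EX := E.filter fun i => ¬(i ∈ J ↔ i + 1 ∈ J) with hEX
  set ET := E.filter fun i => i ∉ J ∧ i + 1 ∉ J with hET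
  have hsplit : ∀ f : ℕ → ℝ≥0∞, ∑ i ∈ E, f i = ∑ i ∈ EJ, f i + ∑ i ∈ EX, f i + ∑ i ∈ ET, f i := by
    intro f
    rw [hEJ, hEX, hET, Finset.sum_filter, Finset.sum_filter, Finset.sum_filter,
      ← Finset.sum_add_distrib, ← Finset.sum_add_distrib]
    refine Finset.sum_congr rfl fun i _ => ?_
    by_cases h1 : i ∈ J <;> by_cases h2 : i + 1 ∈ J <;> simp [h1, h2]
  have hsplit' : ∑ i ∈ E with (i ∈ J ∨ i + 1 ∈ J), ω i = ∑ i ∈ EJ, ω i + ∑ i ∈ EX, ω i := by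
    rw [hEJ, hEX, Finset.sum_filter, Finset.sum_filter, Finset.sum_filter,
      ← Finset.sum_add_distrib]
    refine Finset.sum_congr rfl fun i _ => ?_
    by_cases h1 : i ∈ J <;> by_cases h2 : i + 1 ∈ J <;> simp [h1, h2]
  obtain ⟨x, hx, hxd⟩ := hX J EJ q ω (fun i hi => (Finset.mem_filter.1 hi).2) hJS
    fun i j hij h => hω i j hij (h.trans (Finset.filter_subset _ _))
  obtain ⟨y, hy, hyd⟩ := hY (I \ J) ET q ω
    (fun i hi => by
      obtain ⟨h0, h1, h2⟩ := Finset.mem_filter.1 hi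
      exact ⟨Finset.mem_sdiff.2 ⟨(hE i h0).1, h1⟩, Finset.mem_sdiff.2 ⟨(hE i h0).2, h2⟩⟩)
    (fun i hi => hJT i (Finset.mem_sdiff.1 hi).1 (Finset.mem_sdiff.1 hi).2)
    fun i j hij h => hω i j hij (h.trans (Finset.filter_subset _ _))
  refine ⟨fun i => if i ∈ J then Sum.inl (x i) else Sum.inr (y i), fun i hi => ?_, ?_⟩
  · by_cases h : i ∈ J
    · exact (congrArg (Sum.elim X.label Y.label) (if_pos h)).trans (hx i h)
    · exact (congrArg (Sum.elim X.label Y.label) (if_neg h)).trans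
        (hy i (Finset.mem_sdiff.2 ⟨hi, h⟩))
  · rw [hsplit, hsplit]
    set W := X.join Y hS hT hA P hPS hPT
    set z : ℕ → W.Point := fun i => if i ∈ J then Sum.inl (x i) else Sum.inr (y i)
    have hzx : ∀ i ∈ J, z i = (Sum.inl (x i) : X.Point ⊕ Y.Point) := fun i hi => if_pos hi
    have hzy : ∀ i ∉ J, z i = (Sum.inr (y i) : X.Point ⊕ Y.Point) := fun i hi => if_neg hi
    have b1 : ∑ i ∈ EJ, W.d (z i) (z (i + 1)) ≤ 2 * R * p * ∑ i ∈ EJ, ω i := by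
      refine le_trans (le_of_eq (Finset.sum_congr rfl fun i hi => ?_)) hxd
      obtain ⟨_, h1, h2⟩ := Finset.mem_filter.1 hi
      rw [hzx i h1, hzx (i + 1) h2]
      rfl
    have b2 : ∑ i ∈ ET, W.d (z i) (z (i + 1)) ≤ 2 * R * (p + 1 : ℕ) * ∑ i ∈ ET, ω i := by
      refine le_trans (le_of_eq (Finset.sum_congr rfl fun i hi => ?_)) hyd
      obtain ⟨_, h1, h2⟩ := Finset.mem_filter.1 hi
      rw [hzy i h1, hzy (i + 1) h2]
      rfl
    have b3 : ∑ i ∈ EX, W.d (z i) (z (i + 1)) ≤ 2 * R * (∑ i ∈ EJ, ω i + ∑ i ∈ EX, ω i) := by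
      calc ∑ i ∈ EX, W.d (z i) (z (i + 1)) ≤ ∑ i ∈ EX, δ.diam R A :=
            Finset.sum_le_sum fun i _ => W.d_le _ _
        _ = R * (EX.card * (δ.diam R A / R)) := by
            rw [Finset.sum_const, nsmul_eq_mul, mul_left_comm,
              ENNReal.mul_div_cancel (by simpa using hR) (by simp)]
        _ ≤ R * (2 * (∑ i ∈ EJ, ω i + ∑ i ∈ EX, ω i)) := by
            rw [hsplit'] at hcard
            gcongr
        _ = _ := by ring
    have b4 : 2 * (R : ℝ≥0∞) * ∑ i ∈ EX, ω i ≤ 2 * R * (p + 1 : ℕ) * ∑ i ∈ EX, ω i := by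
      have h1 : (1 : ℝ≥0∞) ≤ (p + 1 : ℕ) := by
        push_cast
        exact le_add_self
      calc 2 * (R : ℝ≥0∞) * ∑ i ∈ EX, ω i = 2 * R * 1 * ∑ i ∈ EX, ω i := by rw [mul_one]
        _ ≤ _ := by gcongr
    calc ∑ i ∈ EJ, W.d (z i) (z (i + 1)) + ∑ i ∈ EX, W.d (z i) (z (i + 1)) +
          ∑ i ∈ ET, W.d (z i) (z (i + 1))
        ≤ 2 * R * p * ∑ i ∈ EJ, ω i + 2 * R * (∑ i ∈ EJ, ω i + ∑ i ∈ EX, ω i) +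
          2 * R * (p + 1 : ℕ) * ∑ i ∈ ET, ω i := by gcongr
      _ = 2 * R * (p + 1 : ℕ) * ∑ i ∈ EJ, ω i + 2 * R * ∑ i ∈ EX, ω i +
          2 * R * (p + 1 : ℕ) * ∑ i ∈ ET, ω i := by push_cast; ring
      _ ≤ 2 * R * (p + 1 : ℕ) * ∑ i ∈ EJ, ω i + 2 * R * (p + 1 : ℕ) * ∑ i ∈ EX, ω i +
          2 * R * (p + 1 : ℕ) * ∑ i ∈ ET, ω i := by gcongr
      _ = _ := by ring

end Join

/-- Strong induction on `A` along `exists_split`. Halving the mass of `S` is what lowers the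
exponent `p` there, while `T` keeps it. -/
theorem exists_partialClan (δ : HopDistance V) {θ N : ℝ} {s R : ℕ} (hθ : 0 < θ)
    (hs : Real.log N < (1 + θ) ^ s * Real.log 2) (hR : 8 * s + 2 ≤ R) {μ : V → ℝ}
    (hμ : ∀ v, 1 ≤ μ v) (A : Finset V) (hA : A.Nonempty) (hAN : ∑ v ∈ A, μ v ≤ N) :
    ∃ X : PartialClan δ R A, X.CloseToChief ∧ X.size μ ≤ (∑ v ∈ A, μ v) ^ (1 + θ) ∧
      ∀ p : ℕ, ∑ v ∈ A, μ v < 2 ^ p → X.PathBound p := by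
  classical
  have hR0 : R ≠ 0 := by omega
  have hμ0 : ∀ v, 0 ≤ μ v := fun v => by linarith [hμ v]
  induction A using Finset.strongInduction with
  | H A ih =>
  rcases hA.exists_eq_singleton_or_nontrivial with ⟨c, rfl⟩ | hA'
  · refine ⟨single δ R c, ?_, ?_, ?_⟩
    · intro u hu v hv
      exact ⟨(), (Finset.mem_singleton.1 hu).symm, by simp [single]⟩
    · simp only [Finset.sum_singleton]
      have h1 : (single δ R c).size μ = μ c := by
        simp only [size]
        exact Fintype.sum_unique (fun x : Unit => μ c)
      rw [h1]
      exact Real.self_le_rpow_of_one_le (hμ c) (by linarith)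
    · intro p _ I E q ω _ hq _
      exact ⟨fun _ => (), fun i hi => (Finset.mem_singleton.1 (hq i hi)).symm, by simp [single]⟩
  · obtain ⟨S, T, hSA, hTA, hST, hhalf, hpow, hball⟩ := δ.exists_split hθ hs hR hμ hA' hAN
    have hsub : ∀ B ⊂ A, ∑ v ∈ B, μ v ≤ ∑ v ∈ A, μ v := fun B hB =>
      Finset.sum_le_sum_of_subset_of_nonneg hB.1 fun v _ _ => hμ0 v
    have hSne : S.Nonempty := by
      rw [Finset.nonempty_iff_ne_empty]
      rintro rfl
      rw [Finset.empty_union] at hST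
      exact hTA.ne hST
    have hTne : T.Nonempty := by
      rw [Finset.nonempty_iff_ne_empty]
      rintro rfl
      rw [Finset.union_empty] at hST
      exact hSA.ne hST
    have hD := δ.diam_pos (R := R) hA'
    have hr0 : 0 < δ.diam R A / R := ENNReal.div_pos hD.ne' (by simp)
    obtain ⟨X, hX1, hX2, hX3⟩ := ih S hSA hSne ((hsub S hSA).trans hAN)
    obtain ⟨Y, hY1, hY2, hY3⟩ := ih T hTA hTne ((hsub T hTA).trans hAN)
    let P : Set V := {v | ∀ u ∈ A, δ.dist 1 u v < δ.diam R A / R → u ∈ S}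
    have hP' : ∀ v ∈ A, v ∉ P → ∀ u ∈ A, δ.dist 1 u v < δ.diam R A / R → u ∈ T :=
      fun v hv hvP => (hball v hv).resolve_left hvP
    refine ⟨X.join Y hSA.1 hTA.1 hD P (fun v hv h => h v hv (by rwa [δ.self]))
      (fun v hv h => hP' v hv h v hv (by rwa [δ.self])), ?_, ?_, ?_⟩
    · exact hX1.join hY1 hR0 (fun v _ h => h) hP'
    · rw [size_join]
      linarith
    · intro p hp
      have hS1 : 1 ≤ ∑ v ∈ S, μ v := by
        obtain ⟨x, hx⟩ := hSne
        exact (hμ x).trans (Finset.single_le_sum (fun v _ => hμ0 v) hx)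
      -- The case `p = 0` is void, since `A` has mass at least 1.
      obtain _ | p := p
      · rw [pow_zero] at hp
        linarith
      · refine (hX3 p ?_).join (hY3 (p + 1) ((hsub T hTA).trans_lt hp)) hR0 hST ?_
        · rw [pow_succ] at hp
          linarith
        · intro u hu v hv huS hvT
          by_contra! h
          rcases hball v hv with h' | h'
          · exact huS (h' u hu h)
          · exact hvT (h' v hv (by rwa [δ.self]))

end PartialClan

/-! ### Walks and hop-constrained distances in weighted graphs -/

variable {V : Type u} {G : SimpleGraph V} {w : Sym2 V → ℝ≥0}

theorem walkWeight_append {a b c : V} (p : G.Walk a b) (q : G.Walk b c) :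
    walkWeight w (p.append q) = walkWeight w p + walkWeight w q := by
  simp [walkWeight]

theorem walkWeight_reverse {a b : V} (p : G.Walk a b) :
    walkWeight w p.reverse = walkWeight w p := by
  simp [walkWeight, List.sum_reverse]

theorem walkWeight_eq_sum {a b : V} (p : G.Walk a b) :
    walkWeight w p = ∑ i ∈ Finset.range p.length, w s(p.getVert i, p.getVert (i + 1)) := by
  induction p with
  | nil => simp [walkWeight]
  | cons h p ih =>
    rw [SimpleGraph.Walk.length_cons, Finset.sum_range_succ']
    simp only [SimpleGraph.Walk.getVert_cons_succ, ← ih]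
    simp [walkWeight, add_comm]

theorem exists_subwalk {a b : V} (p : G.Walk a b) {i j : ℕ} (hij : i ≤ j) (hj : j ≤ p.length) :
    ∃ q : G.Walk (p.getVert i) (p.getVert j), q.toSubgraph ≤ p.toSubgraph ∧
      walkWeight w q = ∑ l ∈ Finset.Ico i j, w s(p.getVert l, p.getVert (l + 1)) := by
  induction j, hij using Nat.le_induction with
  | base =>
    refine ⟨.nil, ?_, by simp [walkWeight]⟩
    rw [SimpleGraph.Walk.toSubgraph, SimpleGraph.singletonSubgraph_le_iff,
      SimpleGraph.Walk.mem_verts_toSubgraph]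
    exact p.getVert_mem_support i
  | succ j hij ih =>
    obtain ⟨q, hq, hqw⟩ := ih (by omega)
    have hadj := p.adj_getVert_succ (i := j) (by omega)
    refine ⟨q.append hadj.toWalk, ?_, ?_⟩
    · rw [SimpleGraph.Walk.toSubgraph_append, SimpleGraph.Adj.toSubgraph_toWalk]
      exact sup_le hq (SimpleGraph.subgraphOfAdj_le_of_adj _
        (p.toSubgraph_adj_getVert (by omega)))
    · rw [walkWeight_append, hqw, Finset.sum_Ico_succ_top hij]
      simp [walkWeight]

theorem hopDist_anti {r r' : ℝ} (h : r ≤ r') (a b : V) : hopDist G w r' a b ≤ hopDist G w r a b :=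
  le_iInf₂ fun p hp => iInf₂_le p (hp.trans h)

theorem graphDist_le_hopDist (r : ℝ) (a b : V) : graphDist G w a b ≤ hopDist G w r a b :=
  le_iInf₂ fun p _ => iInf_le _ p

theorem hopDist_self {r : ℝ} (hr : 0 ≤ r) (a : V) : hopDist G w r a a = 0 := by
  refine le_antisymm ((iInf₂_le SimpleGraph.Walk.nil (by simpa using hr)).trans ?_) zero_le
  simp [walkWeight]

theorem hopDist_symm (r : ℝ) (a b : V) : hopDist G w r a b = hopDist G w r b a := by
  have h : ∀ a b : V, hopDist G w r a b ≤ hopDist G w r b a := fun a b =>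
    le_iInf₂ fun p hp => (iInf₂_le p.reverse (by simpa using hp)).trans (by rw [walkWeight_reverse])
  exact le_antisymm (h a b) (h b a)

theorem hopDist_triangle (r r' : ℝ) (a b c : V) :
    hopDist G w (r + r') a c ≤ hopDist G w r a b + hopDist G w r' b c := by
  rw [hopDist, hopDist, hopDist]
  refine ENNReal.le_of_forall_pos_le_add fun ε hε hfin => ?_
  obtain ⟨h1, h2⟩ := ENNReal.add_lt_top.1 hfin
  have hε' : (ε / 2 : ℝ≥0∞) ≠ 0 := by simpa using hε.ne'
  have hp := ENNReal.lt_add_right h1.ne hε'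
  have hq := ENNReal.lt_add_right h2.ne hε'
  obtain ⟨p, hp⟩ := iInf_lt_iff.1 hp
  obtain ⟨hpr, hp⟩ := iInf_lt_iff.1 hp
  obtain ⟨q, hq⟩ := iInf_lt_iff.1 hq
  obtain ⟨hqr, hq⟩ := iInf_lt_iff.1 hq
  refine (iInf₂_le (p.append q) ?_).trans ?_
  · rw [SimpleGraph.Walk.length_append]
    push_cast
    linarith
  · rw [walkWeight_append]
    push_cast
    refine (add_le_add hp.le hq.le).trans (le_of_eq ?_)
    rw [add_add_add_comm, ENNReal.add_halves]

theorem graphDist_pos [Finite V] (hw : ∀ e ∈ G.edgeSet, 0 < w e) {a b : V} (hab : a ≠ b) :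
    0 < graphDist G w a b := by
  obtain ⟨ε, hε, hεw⟩ : ∃ ε : ℝ≥0, 0 < ε ∧ ∀ e ∈ G.edgeSet, ε ≤ w e := by
    rcases G.edgeSet.eq_empty_or_nonempty with h | h
    · exact ⟨1, one_pos, by simp [h]⟩
    · obtain ⟨e, he, hmin⟩ := Set.exists_min_image G.edgeSet w (Set.toFinite _) h
      exact ⟨w e, hw e he, hmin⟩
  refine lt_of_lt_of_le (ENNReal.coe_pos.2 hε) (le_iInf fun p => ?_)
  cases p with
  | nil => exact absurd rfl hab
  | cons h p =>
    rw [ENNReal.coe_le_coe]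
    refine (hεw _ ((SimpleGraph.mem_edgeSet G).2 h)).trans ?_
    simp [walkWeight]

/-- The hop-constrained distances of a weighted graph, with `h` hops as the unit. -/
noncomputable def hopDistance [Finite V] (G : SimpleGraph V) (w : Sym2 V → ℝ≥0)
    (hw : ∀ e ∈ G.edgeSet, 0 < w e) (h : ℕ) : HopDistance V where
  dist j := hopDist G w ((j : ℝ) * h)
  self j a := hopDist_self (by positivity) a
  symm j := hopDist_symm _
  triangle i j a b c := by
    push_cast
    rw [add_mul]
    exact hopDist_triangle _ _ a b c
  pos j a b hab := (graphDist_pos hw hab).trans_le (graphDist_le_hopDist _ a b)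

/-! ### From partial clans to clan embeddings -/

namespace PartialClan

open Classical in
/-- A partial clan embedding of all vertices is a clan embedding. -/
noncomputable def toClanEmbedding [Fintype V] {hw : ∀ e ∈ G.edgeSet, 0 < w e} {h R : ℕ}
    (X : PartialClan (hopDistance G w hw h) R Finset.univ) : ClanEmbedding G w where
  Point := X.Point
  finite_point := inferInstance
  emetric :=
    { edist := X.d
      edist_self := X.d_self
      edist_comm := X.d_symm
      edist_triangle := fun x y z => (X.ultra x y z).trans (max_le_add_of_nonneg zero_le zero_le)
      eq_of_edist_eq_zero := fun {x y} => X.eq_of_d x y }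
  ultra := X.ultra
  clan v := Finset.univ.filter fun x => X.label x = v
  chief := X.chief
  chief_mem v := by simpa using X.label_chief v (Finset.mem_univ v)
  clan_disjoint a b hab := by
    rw [Finset.disjoint_left]
    intro x hx hx'
    simp only [Finset.mem_filter] at hx hx'
    exact hab (hx.2.symm.trans hx'.2)
  dominating a b x hx y hy := by
    simp only [Finset.mem_filter] at hx hy
    rw [← hx.2, ← hy.2]
    exact (graphDist_le_hopDist _ _ _).trans (X.le_d x y)

variable [Fintype V] {hw : ∀ e ∈ G.edgeSet, 0 < w e} {h R : ℕ}
  {X : PartialClan (hopDistance G w hw h) R Finset.univ}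

theorem mem_clan_iff {x : X.Point} {v : V} :
    (show X.toClanEmbedding.Point from x) ∈ X.toClanEmbedding.clan v ↔ X.label x = v := by
  classical
  exact ⟨fun h => (Finset.mem_filter.1 h).2,
    fun h => Finset.mem_filter.2 ⟨Finset.mem_univ (α := X.Point) x, h⟩⟩

theorem CloseToChief.hasHopDistortion (hX : X.CloseToChief) {t β : ℝ} (ht : R ≤ t) (hβ : R ≤ β) :
    X.toClanEmbedding.HasHopDistortion t β h := by
  intro a b
  constructor
  · intro x hx y hy
    rw [← mem_clan_iff.1 hx, ← mem_clan_iff.1 hy]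
    exact (hopDist_anti (by gcongr) _ _).trans (X.le_d x y)
  · obtain ⟨x, hx, hxd⟩ := hX a (Finset.mem_univ a) b (Finset.mem_univ b)
    refine ⟨x, mem_clan_iff.2 hx, hxd.trans ?_⟩
    have h1 : (R : ℝ≥0∞) ≤ ENNReal.ofReal t := by
      rw [← ENNReal.ofReal_natCast]
      exact ENNReal.ofReal_le_ofReal ht
    have h2 : (hopDistance G w hw h).dist 1 a b = hopDist G w h a b := by simp [hopDistance]
    rw [h2]
    gcongr

/-- Being `h`-respecting supplies the hypothesis of `PathBound`: a segment of the walk stays in its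
subgraph, so its weight bounds the `h`-hop distance of its ends. -/
theorem PathBound.hasHopPathDistortion {p : ℕ} (hX : X.PathBound p) {t : ℝ} (ht : 2 * R * p ≤ t) :
    X.toClanEmbedding.HasHopPathDistortion t h := by
  intro a b P hP
  obtain ⟨x, hx, hxd⟩ := hX (Finset.range (P.length + 1)) (Finset.range P.length) P.getVert
    (fun l => w s(P.getVert l, P.getVert (l + 1))) (fun i hi => by simp at hi ⊢; omega)
    (fun i _ => Finset.mem_univ _) (by
      intro i j hij hsub
      have hj : j ≤ P.length := by
        have := Finset.mem_range.1 (hsub (Finset.mem_Ico.2 (⟨by omega, by omega⟩ : i ≤ j - 1 ∧ j - 1 < j)))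
        omega
      obtain ⟨Q, hQ, hQw⟩ := exists_subwalk (w := w) P hij.le hj
      have hmem : ∀ i, P.getVert i ∈ P.toSubgraph.verts := fun i =>
        (SimpleGraph.Walk.mem_verts_toSubgraph P).2 (P.getVert_mem_support i)
      calc (hopDistance G w hw h).dist 1 (P.getVert i) (P.getVert j)
          = hopDist G w h (P.getVert i) (P.getVert j) := by simp [hopDistance]
        _ ≤ subgraphDist w P.toSubgraph (P.getVert i) (P.getVert j) := hP _ (hmem i) _ (hmem j)
        _ ≤ walkWeight w Q := iInf₂_le Q hQ
        _ = _ := by rw [hQw]; push_cast; rfl)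
  refine ⟨x, fun i hi => ?_, hxd.trans ?_⟩
  · exact mem_clan_iff.2 (hx i (Finset.mem_range.2 (by omega)))
  · have h1 : (2 * R * p : ℝ≥0∞) ≤ ENNReal.ofReal t := by
      have : (2 * R * p : ℝ≥0∞) = ((2 * R * p : ℕ) : ℝ≥0∞) := by push_cast; rfl
      rw [this, ← ENNReal.ofReal_natCast]
      exact ENNReal.ofReal_le_ofReal (by push_cast; exact ht)
    rw [walkWeight_eq_sum]
    push_cast
    gcongr

theorem sum_mul_card_clan (X : PartialClan (hopDistance G w hw h) R Finset.univ) (μ : V → ℝ) :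
    ∑ v, μ v * (X.toClanEmbedding.clan v).card = X.size μ := by
  classical
  rw [size, ← Finset.sum_fiberwise_of_maps_to (t := Finset.univ) (g := X.label)
    (fun _ _ => Finset.mem_univ _)]
  refine Finset.sum_congr rfl fun v _ => ?_
  rw [Finset.sum_congr rfl (fun x hx => by rw [(Finset.mem_filter.1 hx).2] :
    ∀ x ∈ Finset.univ.filter (fun x => X.label x = v), μ (X.label x) = μ v), Finset.sum_const,
    nsmul_eq_mul, mul_comm]
  simp only [toClanEmbedding]

end PartialClan

-- The minimax principle

universe v

theorem tsum_map_mul {ι : Type v} {α : Type u} (p : PMF ι) (a : ι → α) (g : α → ℝ≥0∞) :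
    ∑' x, p.map a x * g x = ∑' i, p i * g (a i) := by
  classical
  calc ∑' x, p.map a x * g x = ∑' x, ∑' i, (if x = a i then p i else 0) * g x :=
        tsum_congr fun x => by rw [PMF.map_apply, ENNReal.tsum_mul_right]
    _ = ∑' i, ∑' x, (if x = a i then p i else 0) * g x := ENNReal.tsum_comm
    _ = _ := tsum_congr fun i => by
      rw [tsum_eq_single (a i) fun x hx => by rw [if_neg hx, zero_mul], if_pos rfl]

/-- The minimax principle: if for every probability weighting `μ` of `V` some good `a` has
`μ`-average at most `b`, then some distribution over good elements has all expectations below any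
`β > b`. -/
theorem exists_pmf_of_forall_weight {V : Type v} [Fintype V] [Nonempty V] {α : Type u}
    {good : α → Prop} (f : α → V → ℕ) {b β : ℝ} (hb : b < β)
    (hf : ∀ μ : V → ℝ, (∀ v, 0 ≤ μ v) → ∑ v, μ v = 1 → ∃ a, good a ∧ ∑ v, μ v * f a v ≤ b) :
    ∃ D : PMF α, (∀ a ∈ D.support, good a) ∧ ∀ v, ∑' a, D a * (f a v : ℝ≥0∞) ≤ ENNReal.ofReal β := by
  classical
  -- A common point of `K` and the open orthant `U` is the desired mixture, with finite support.
  -- Otherwise a separating functional, normalised, is a weighting that contradicts `hf`.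
  set K : Set (V → ℝ) := convexHull ℝ ((fun a v => (f a v : ℝ)) '' {a | good a}) with hK
  set U : Set (V → ℝ) := Set.pi Set.univ fun _ => Set.Iio β with hU
  have hfK : ∀ a, good a → (fun v => (f a v : ℝ)) ∈ K := fun a ha =>
    subset_convexHull ℝ _ ⟨a, ha, rfl⟩
  by_cases hdisj : Disjoint U K
  · exfalso
    obtain ⟨φ, c, hφU, hφK⟩ := geometric_hahn_banach_open
      (convex_pi fun _ _ => convex_Iio β) (isOpen_set_pi Set.finite_univ fun _ _ => isOpen_Iio)
      (convex_convexHull ℝ _) hdisj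
    set μ : V → ℝ := fun v => φ (Pi.single v 1) with hμ
    have hφ : ∀ y : V → ℝ, φ y = ∑ v, μ v * y v := by
      intro y
      conv_lhs => rw [← Finset.univ_sum_single y]
      rw [map_sum]
      refine Finset.sum_congr rfl fun v _ => ?_
      have : (Pi.single v (y v) : V → ℝ) = y v • Pi.single v 1 := by
        rw [← Pi.single_smul, smul_eq_mul, mul_one]
      rw [this, map_smul, smul_eq_mul, mul_comm]
    -- A negative coefficient would make the functional unbounded above on `U`, by sending that
    -- coordinate to `-∞`.
    have hμ0 : ∀ v, 0 ≤ μ v := by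
      intro v
      by_contra! hneg
      have h0 := hφU (fun _ => β - 1) fun _ _ => by simp
      set t := (c - φ fun _ => β - 1) / -μ v with ht
      have ht0 : 0 ≤ t := div_nonneg (by linarith) (by linarith)
      have h1 := hφU ((fun _ => β - 1) - t • Pi.single v 1) fun i _ => by
        have : 0 ≤ t * (Pi.single v 1 : V → ℝ) i := by
          refine mul_nonneg ht0 ?_
          rw [Pi.single_apply]
          split_ifs <;> norm_num
        simp only [Pi.sub_apply, Pi.smul_apply, smul_eq_mul, Set.mem_Iio]
        linarith
      rw [map_sub, map_smul, smul_eq_mul] at h1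
      have h2 : t * μ v = -(c - φ fun _ => β - 1) := by
        rw [ht, div_mul_eq_mul_div, div_eq_iff (by linarith)]
        ring
      change (φ fun _ => β - 1) - t * μ v < c at h1
      linarith
    set σ := ∑ v, μ v with hσ
    have hσ0 : 0 ≤ σ := Finset.sum_nonneg fun v _ => hμ0 v
    -- A constant vector strictly between `b` and `β` keeps a gap above `b`. When `σ = 0` it still
    -- gives `0 < c`, against the value 0 on `K`.
    have hmid : σ * ((b + β) / 2) < c := by
      have h1 := hφU (fun _ => (b + β) / 2) fun _ _ => by
        simp only [Set.mem_Iio]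
        linarith
      rwa [hφ, ← Finset.sum_mul] at h1
    rcases hσ0.eq_or_lt with h0 | hpos
    · obtain ⟨a, ha, -⟩ := hf (fun _ => 1 / Fintype.card V) (fun _ => by positivity) (by simp)
      have h1 := hφK _ (hfK a ha)
      have hμz : ∀ v, μ v = 0 := fun v =>
        (Finset.sum_eq_zero_iff_of_nonneg fun v _ => hμ0 v).1 h0.symm v (Finset.mem_univ v)
      rw [hφ] at h1
      simp only [hμz, zero_mul, Finset.sum_const_zero] at h1
      rw [← h0, zero_mul] at hmid
      linarith
    · obtain ⟨a, ha, hab⟩ := hf (fun v => μ v / σ) (fun v => div_nonneg (hμ0 v) hσ0)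
        (by rw [← Finset.sum_div, div_self hpos.ne'])
      have h1 := hφK _ (hfK a ha)
      rw [hφ] at h1
      have h2 : ∑ v, μ v / σ * f a v = (∑ v, μ v * f a v) / σ := by
        rw [Finset.sum_div]
        exact Finset.sum_congr rfl fun v _ => by ring
      rw [h2, div_le_iff₀ hpos] at hab
      nlinarith
  · obtain ⟨x, hxU, hxK⟩ := Set.not_disjoint_iff.1 hdisj
    obtain ⟨ι, _, p, z, hp0, hp1, hz, hx⟩ := mem_convexHull_iff_exists_fintype.1 hxK
    choose a ha haz using hz
    have hsum : ∑ i, ENNReal.ofReal (p i) = 1 := by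
      rw [← ENNReal.ofReal_sum_of_nonneg fun i _ => hp0 i, hp1, ENNReal.ofReal_one]
    refine ⟨(PMF.ofFintype _ hsum).map a, ?_, fun v => ?_⟩
    · intro y hy
      rw [PMF.support_map] at hy
      obtain ⟨i, -, rfl⟩ := hy
      exact ha i
    · rw [tsum_map_mul, tsum_fintype]
      calc ∑ i, PMF.ofFintype _ hsum i * (f (a i) v : ℝ≥0∞)
          = ∑ i, ENNReal.ofReal (p i * f (a i) v) := by
            refine Finset.sum_congr rfl fun i _ => ?_
            rw [PMF.ofFintype_apply, ENNReal.ofReal_mul (hp0 i), ENNReal.ofReal_natCast]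
        _ = ENNReal.ofReal (x v) := by
            rw [← ENNReal.ofReal_sum_of_nonneg fun i _ => mul_nonneg (hp0 i) (Nat.cast_nonneg _)]
            congr 1
            rw [← hx, Finset.sum_apply]
            refine Finset.sum_congr rfl fun i _ => ?_
            rw [← haz i]
            rfl
        _ ≤ _ := ENNReal.ofReal_le_ofReal (le_of_lt (hxU v (Set.mem_univ v)))

theorem ClanEmbedding.HasHopDistortion.mono {V : Type u} {G : SimpleGraph V} {w : Sym2 V → ℝ≥0}
    {F : ClanEmbedding G w} {t t' β β' : ℝ} {h : ℕ} (hF : F.HasHopDistortion t β h) (ht : t ≤ t')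
    (hβ : β ≤ β') : F.HasHopDistortion t' β' h := by
  intro a b
  obtain ⟨h1, x, hx, hxd⟩ := hF a b
  refine ⟨fun x hx y hy => (hopDist_anti (by gcongr) a b).trans (h1 x hx y hy), x, hx, hxd.trans ?_⟩
  gcongr

theorem ClanEmbedding.HasHopPathDistortion.mono {V : Type u} {G : SimpleGraph V}
    {w : Sym2 V → ℝ≥0} {F : ClanEmbedding G w} {t t' : ℝ} {h : ℕ}
    (hF : F.HasHopPathDistortion t h) (ht : t ≤ t') : F.HasHopPathDistortion t' h := by
  intro a b p hp
  obtain ⟨x, hx, hxd⟩ := hF a b p hp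
  refine ⟨x, hx, hxd.trans ?_⟩
  gcongr

/-! ### Choice of parameters and the two distributions -/

theorem one_lt_log_of_three_le {n : ℕ} (hn : 3 ≤ n) : 1 < Real.log n := by
  rw [Real.lt_log_iff_exp_lt (by positivity)]
  have : (3 : ℝ) ≤ n := by exact_mod_cast hn
  linarith [Real.exp_one_lt_three]

theorem log_two_mul_le {n : ℕ} (hn : 3 ≤ n) : Real.log (2 * n) ≤ 2 * Real.log n := by
  have h3 : (3 : ℝ) ≤ n := by exact_mod_cast hn
  rw [Real.log_mul (by norm_num) (by linarith)]
  linarith [Real.log_le_log (by norm_num) (show (2 : ℝ) ≤ n by linarith)]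

theorem exists_parameters : ∃ C : ℝ, 0 < C ∧ ∀ (n : ℕ) (θ : ℝ), 3 ≤ n → 0 < θ → θ ≤ 1 →
    ∃ s R p : ℕ, Real.log (2 * n) < (1 + θ) ^ s * Real.log 2 ∧ 8 * s + 2 ≤ R ∧
      (2 * n : ℝ) < 2 ^ p ∧ R ≤ C * (Real.log (Real.log n) / θ) ∧
      2 * R * p ≤ C * (Real.log n * Real.log (Real.log n) / θ) := by
  -- The minimum of `log log n` over `n ≥ 3`; additive constants are absorbed through `1 ≤ ℓ / c₀`.
  set c₀ := Real.log (Real.log (3 : ℕ)) with hc₀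
  have hc₀pos : 0 < c₀ := Real.log_pos (one_lt_log_of_three_le le_rfl)
  refine ⟨8 * (42 / c₀ + 16), by positivity, fun n θ hn hθ hθ1 => ?_⟩
  have hn3 : (3 : ℝ) ≤ n := by exact_mod_cast hn
  have hlog := one_lt_log_of_three_le hn
  set ℓ := Real.log (Real.log n) with hℓ
  have hcℓ : c₀ ≤ ℓ := by
    refine Real.log_le_log (by linarith [one_lt_log_of_three_le (le_refl 3)]) ?_
    exact Real.log_le_log (by norm_num) (by exact_mod_cast hn)
  have hℓ1 : 1 ≤ ℓ / c₀ := (one_le_div hc₀pos).2 hcℓ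
  have hℓ0 : 0 < ℓ := by linarith
  have hlog2 := Real.log_two_gt_d9
  have hlog2n := log_two_mul_le hn
  have hlog2n' : Real.log 2 ≤ Real.log (2 * n) := Real.log_le_log (by norm_num) (by linarith)
  set x := Real.log (Real.log (2 * n) / Real.log 2) with hx
  have hx0 : 0 ≤ x := Real.log_nonneg ((one_le_div (by linarith)).2 hlog2n')
  have hxℓ : x ≤ 2 + ℓ := by
    have h1 : Real.log (2 * n) / Real.log 2 ≤ 4 * Real.log n := by
      rw [div_le_iff₀ (by linarith)]
      nlinarith
    have h2 : x ≤ Real.log (4 * Real.log n) := Real.log_le_log (div_pos (by linarith) (by linarith)) h1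
    rw [Real.log_mul (by norm_num) (by linarith)] at h2
    have h3 : Real.log 4 = 2 * Real.log 2 := by
      rw [show (4 : ℝ) = 2 ^ 2 by norm_num, Real.log_pow]
      norm_num
    linarith [Real.log_two_lt_d9]
  have hθlog : θ / 2 ≤ Real.log (1 + θ) := by
    refine le_trans ?_ (Real.le_log_one_add_of_nonneg hθ.le)
    rw [div_le_div_iff₀ (by norm_num) (by linarith)]
    nlinarith
  have hθlog0 : 0 < Real.log (1 + θ) := by linarith
  set s := ⌊x / Real.log (1 + θ)⌋₊ + 1 with hs
  have hs1 : x < s * Real.log (1 + θ) := by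
    rw [← div_lt_iff₀ hθlog0, hs]
    push_cast
    exact Nat.lt_floor_add_one _
  have hs2 : (s : ℝ) ≤ (5 / c₀ + 2) * (ℓ / θ) := by
    have h1 : (s : ℝ) ≤ x / Real.log (1 + θ) + 1 := by
      rw [hs]
      push_cast
      linarith [Nat.floor_le (div_nonneg hx0 hθlog0.le)]
    have h2 : x / Real.log (1 + θ) ≤ (2 + ℓ) / (θ / 2) := by gcongr
    have h3 : (1 : ℝ) ≤ 1 / θ := (one_le_div hθ).2 hθ1
    have h4 : (2 + ℓ) / (θ / 2) = 4 * (1 / θ) + 2 * (ℓ / θ) := by field_simp; ring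
    have h5 : 1 / θ ≤ ℓ / c₀ * (1 / θ) := le_mul_of_one_le_left (by positivity) hℓ1
    have h6 : (5 / c₀ + 2) * (ℓ / θ) = 5 * (ℓ / c₀ * (1 / θ)) + 2 * (ℓ / θ) := by field_simp
    linarith
  have hR : ((8 * s + 2 : ℕ) : ℝ) ≤ (42 / c₀ + 16) * (ℓ / θ) := by
    have h3 : (1 : ℝ) ≤ 1 / θ := (one_le_div hθ).2 hθ1
    have h5 : 1 / θ ≤ ℓ / c₀ * (1 / θ) := le_mul_of_one_le_left (by positivity) hℓ1
    have h6 : (42 / c₀ + 16) * (ℓ / θ) = 8 * ((5 / c₀ + 2) * (ℓ / θ)) + 2 * (ℓ / c₀ * (1 / θ)) := by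
      field_simp; ring
    push_cast
    linarith
  set p := Nat.log 2 (2 * n) + 1 with hp
  have hp1 : (p : ℝ) ≤ 4 * Real.log n := by
    have h1 : 2 ^ Nat.log 2 (2 * n) ≤ 2 * n := Nat.pow_log_le_self 2 (by omega)
    have h2 : ((2 : ℝ) ^ Nat.log 2 (2 * n)) ≤ 2 * n := by exact_mod_cast h1
    have h3 := Real.log_le_log (by positivity) h2
    rw [Real.log_pow] at h3
    rw [hp]
    push_cast
    nlinarith [Nat.cast_nonneg (α := ℝ) (Nat.log 2 (2 * n))]
  have hR0 : 0 ≤ (42 / c₀ + 16) * (ℓ / θ) := by positivity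
  refine ⟨s, 8 * s + 2, p, ?_, le_rfl, ?_, ?_, ?_⟩
  · rw [← div_lt_iff₀ (by linarith)]
    rw [← Real.log_lt_log_iff (div_pos (by linarith) (by linarith)) (by positivity), Real.log_pow]
    exact hs1
  · exact_mod_cast Nat.lt_pow_succ_log_self (by norm_num) (2 * n)
  · linarith
  · calc 2 * ((8 * s + 2 : ℕ) : ℝ) * p
        ≤ 2 * ((42 / c₀ + 16) * (ℓ / θ)) * (4 * Real.log n) := by gcongr
      _ = _ := by ring

/-- For a probability weighting `μ`, the recursion is run with `n * μ v + 1`, which is at least 1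
and has total `2 * n`. Its size bound splits as `n * ∑ μ |f| + ∑ |f| ≤ (2n)^(1+θ)`. -/
theorem exists_clanDistribution : ∃ C : ℝ, 0 < C ∧
    ∀ (V : Type u) [Fintype V] (G : SimpleGraph V) (w : Sym2 V → ℝ≥0) (n h : ℕ) (θ β : ℝ),
      (∀ e ∈ G.edgeSet, 0 < w e) → Fintype.card V = n → 3 ≤ n → 0 < θ → θ ≤ 1 →
      2 * (2 * n : ℝ) ^ θ - 1 < β →
      ∃ D : PMF (ClanEmbedding G w),
        (∀ F ∈ D.support,
          F.HasHopDistortion (C * (Real.log (Real.log n) / θ)) (C * (Real.log (Real.log n) / θ)) h ∧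
          F.HasHopPathDistortion (C * (Real.log n * Real.log (Real.log n) / θ)) h) ∧
        ∀ v : V, expectedClanSize D v ≤ ENNReal.ofReal β := by
  obtain ⟨C, hC, hpar⟩ := exists_parameters
  refine ⟨C, hC, fun V _ G w n h θ β hw hcard hn hθ hθ1 hβ => ?_⟩
  obtain ⟨s, R, p, hs, hR, hp, hRC, hRp⟩ := hpar n θ hn hθ hθ1
  have hn0 : (0 : ℝ) < n := by exact_mod_cast (by omega : 0 < n)
  have : Nonempty V := Fintype.card_pos_iff.1 (by omega)
  refine exists_pmf_of_forall_weight (fun (F : ClanEmbedding G w) v => (F.clan v).card) hβ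
    fun μ hμ0 hμ1 => ?_
  have hsum : ∑ v, (n * μ v + 1) = (2 * n : ℝ) := by
    rw [Finset.sum_add_distrib, ← Finset.mul_sum, hμ1]
    simp [hcard]
    ring
  obtain ⟨X, hX1, hX2, hX3⟩ := PartialClan.exists_partialClan (hopDistance G w hw h) hθ hs hR
    (μ := fun v => n * μ v + 1) (fun v => by linarith [mul_nonneg hn0.le (hμ0 v)]) Finset.univ
    Finset.univ_nonempty hsum.le
  refine ⟨X.toClanEmbedding, ⟨hX1.hasHopDistortion hRC hRC,
    (hX3 p (by rw [hsum]; exact hp)).hasHopPathDistortion hRp⟩, ?_⟩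
  rw [← X.sum_mul_card_clan, hsum] at hX2
  -- Clans are non-empty. Subtracting this gives the `- 1` in `2 * (2 * n) ^ θ - 1`, without which a
  -- bound near 1 would be out of reach.
  have hge : (n : ℝ) ≤ ∑ v, ((X.toClanEmbedding.clan v).card : ℝ) := by
    calc (n : ℝ) = ∑ v : V, (1 : ℝ) := by simp [hcard]
      _ ≤ _ := Finset.sum_le_sum fun v _ => by
        exact_mod_cast Finset.card_pos.2 ⟨_, X.toClanEmbedding.chief_mem v⟩
  have hexp : ∑ v, (n * μ v + 1) * ((X.toClanEmbedding.clan v).card : ℝ) =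
      n * ∑ v, μ v * (X.toClanEmbedding.clan v).card +
        ∑ v, ((X.toClanEmbedding.clan v).card : ℝ) := by
    rw [Finset.mul_sum, ← Finset.sum_add_distrib]
    exact Finset.sum_congr rfl fun v _ => by ring
  rw [hexp, Real.rpow_add (by linarith), Real.rpow_one] at hX2
  refine le_of_mul_le_mul_left ?_ hn0
  linarith

end HopClan

theorem theorem4 :
    ∃ C : ℝ, 0 < C ∧
      ∀ (V : Type*) [Fintype V] (G : SimpleGraph V) (w : Sym2 V → ℝ≥0) (n h : ℕ),
        (∀ e ∈ G.edgeSet, 0 < w e) → Fintype.card V = n → 3 ≤ n → 1 ≤ h → h ≤ n →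
        (∀ k : ℕ, 1 ≤ k → k ≤ n →
          ∃ D : PMF (HopClan.ClanEmbedding G w),
            (∀ F ∈ D.support,
              F.HasHopDistortion (C * (k * Real.log (Real.log n)))
                (C * (k * Real.log (Real.log n))) h ∧
              F.HasHopPathDistortion (C * (k * Real.log n * Real.log (Real.log n))) h) ∧
            ∀ v : V, HopClan.expectedClanSize D v ≤
              ENNReal.ofReal (C * (n : ℝ) ^ (1 / (k : ℝ)))) ∧
        (∀ ε : ℝ, 0 < ε → ε < 1 →
          ∃ D : PMF (HopClan.ClanEmbedding G w),
            (∀ F ∈ D.support,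
              F.HasHopDistortion (C * (Real.log n * Real.log (Real.log n) / ε))
                (C * (Real.log n * Real.log (Real.log n) / ε)) h ∧
              F.HasHopPathDistortion
                (C * (Real.log n ^ 2 * Real.log (Real.log n) / ε)) h) ∧
            ∀ v : V, HopClan.expectedClanSize D v ≤ ENNReal.ofReal (1 + ε)) := by
  obtain ⟨C, hC, hmain⟩ := HopClan.exists_clanDistribution
  -- The 4 serves `2 * (2n)^(1/k) ≤ 4 * n^(1/k)`; the 16 comes from `θ = ε / (16 * log n)`.
  refine ⟨16 * C + 4, by positivity, fun V _ G w n h hw hcard hn _ _ => ⟨?_, ?_⟩⟩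
  all_goals
    have hn3 : (3 : ℝ) ≤ n := by exact_mod_cast hn
    have hlog := HopClan.one_lt_log_of_three_le hn
    have hℓ : 0 < Real.log (Real.log n) := Real.log_pos hlog
  · intro k hk _
    have hk1 : (1 : ℝ) ≤ k := by exact_mod_cast hk
    have hθ1 : 1 / (k : ℝ) ≤ 1 := (div_le_one (by linarith)).2 hk1
    obtain ⟨D, hD, hDv⟩ := hmain V G w n h (1 / k) (4 * (n : ℝ) ^ (1 / (k : ℝ))) hw hcard hn
      (by positivity) hθ1 (by
        rw [Real.mul_rpow (by norm_num) (by linarith)]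
        have h2 : (2 : ℝ) ^ (1 / (k : ℝ)) ≤ 2 := by
          simpa using Real.rpow_le_rpow_of_exponent_le (by norm_num : (1 : ℝ) ≤ 2) hθ1
        nlinarith [Real.rpow_nonneg (by linarith : (0 : ℝ) ≤ n) (1 / (k : ℝ))])
    refine ⟨D, fun F hF => ⟨(hD F hF).1.mono ?_ ?_, (hD F hF).2.mono ?_⟩, fun v => (hDv v).trans ?_⟩
    · rw [div_div_eq_mul_div, div_one, mul_comm (Real.log (Real.log n))]
      gcongr
      linarith
    · rw [div_div_eq_mul_div, div_one, mul_comm (Real.log (Real.log n))]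
      gcongr
      linarith
    · rw [div_div_eq_mul_div, div_one, mul_comm _ (k : ℝ), ← mul_assoc (k : ℝ)]
      gcongr
      linarith
    · refine ENNReal.ofReal_le_ofReal ?_
      gcongr
      linarith
  · intro ε hε hε1
    have hL : 0 < Real.log n := by linarith
    set θ := ε / (16 * Real.log n) with hθ
    have hθ0 : 0 < θ := by positivity
    have hθ1 : θ ≤ 1 := (div_le_one (by positivity)).2 (by linarith)
    -- Then `2 * (2n)^θ - 1 ≤ 1 + ε / 2`, strictly below `1 + ε` as the minimax step requires.
    have hpow : (2 * n : ℝ) ^ θ ≤ 1 + ε / 4 := by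
      rw [Real.rpow_def_of_pos (by linarith)]
      have h1 : Real.log (2 * n) * θ ≤ ε / 8 := by
        calc Real.log (2 * n) * θ ≤ 2 * Real.log n * θ := by
              gcongr
              exact HopClan.log_two_mul_le hn
          _ = ε / 8 := by rw [hθ]; field_simp; norm_num
      have h2 : ε / 8 ≤ Real.log (1 + ε / 4) := by
        refine le_trans ?_ (Real.le_log_one_add_of_nonneg (by positivity))
        rw [div_le_div_iff₀ (by norm_num) (by linarith)]
        nlinarith
      calc Real.exp (Real.log (2 * n) * θ) ≤ Real.exp (Real.log (1 + ε / 4)) :=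
            Real.exp_le_exp.2 (h1.trans h2)
        _ = _ := Real.exp_log (by linarith)
    obtain ⟨D, hD, hDv⟩ := hmain V G w n h θ (1 + ε) hw hcard hn hθ0 hθ1 (by linarith)
    have e1 : C * (Real.log (Real.log n) / θ) =
        16 * C * (Real.log n * Real.log (Real.log n) / ε) := by
      rw [hθ]
      field_simp
    have e2 : C * (Real.log n * Real.log (Real.log n) / θ) =
        16 * C * (Real.log n ^ 2 * Real.log (Real.log n) / ε) := by
      rw [hθ]
      field_simp
    refine ⟨D, fun F hF => ⟨(hD F hF).1.mono ?_ ?_, (hD F hF).2.mono ?_⟩, hDv⟩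
    · rw [e1]
      gcongr
      linarith
    · rw [e1]
      gcongr
      linarith
    · rw [e2]
      gcongr
      linarith
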